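/- Let $G$ be a real (finite-dimensional, $C^\infty$) nilpotent Lie group with Lie algebra $\mathfrak g$, i.e. $\mathfrak g$ is nilpotent. Let $J$ be a left-invariant complex structure on $G$ (a left-invariant smooth field of endomorphisms of $TG$ with $J^2=-1$ and vanishing Nijenhuis tensor) which is nilpotent in the sense of Cordero–Fernández–Gray–Ugarte: the ascending series $\mathfrak a_0=0$, $\mathfrak a_{l+1}=\{X\in\mathfrak g : [X,\mathfrak g]\subseteq\mathfrak a_l \text{ and } [JX,\mathfrak g]\subseteq \mathfrak a_l\}$ satisfies $\mathfrak a_s=\mathfrak g$ for some $s$. Let $g$ be a left-invariant Riemannian metric on $G$ compatible with $J$, i.e. $g(JX,JY)=g(X,Y)$. Let $\nabla^b$ be the Bismut connection of $(G,g,J)$, that is, the unique linear connection with $\nabla^b g=0$, $\nabla^b J=0$ and such that $(X,Y,Z)\mapsto g(T^b(X,Y),Z)$ is totally skew-symmetric, where $T^b$ is the torsion of $\nabla^b$; let $R^b$ be the curvature of $\nabla^b$. If $g$ is BTP (Bismut torsion parallel), i.e. $\nabla^bT^b=0$, then $g$ is BAS (Bismut Ambrose–Singer), i.e. $\nabla^bT^b=0$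 and $\nabla^bR^b=0$. -/

import Mathlib

open Bundle
open scoped Manifold ContDiff

namespace BismutNil

instance instLEInftyMinSmoothnessThree : ENat.LEInfty (minSmoothness ℝ 3) :=
  ⟨by simpa using (ENat.LEInfty.out : (3 : ℕ∞ω) ≤ ∞)⟩

section Manifold

variable {E : Type*} [NormedAddCommGroup E] [NormedSpace ℝ E]
  {M : Type*} [TopologicalSpace M] [ChartedSpace E M]

/-- Smoothness (`C^∞`) of a vector field on `M`. -/
def IsSmoothField [IsManifold 𝓘(ℝ, E) ∞ M] (X : Π x : M, TangentSpace 𝓘(ℝ, E) x) : Prop :=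
  ContMDiff 𝓘(ℝ, E) 𝓘(ℝ, E).tangent ∞ (fun x ↦ (⟨x, X x⟩ : TangentBundle 𝓘(ℝ, E) M))

/-- An integrable almost complex structure: a smooth field `J` of endomorphisms of the tangent
spaces with `J² = -1` and vanishing Nijenhuis tensor. -/
structure IsComplexStructure [IsManifold 𝓘(ℝ, E) ∞ M]
    (J : Π x : M, TangentSpace 𝓘(ℝ, E) x →L[ℝ] TangentSpace 𝓘(ℝ, E) x) : Prop where
  smooth : ContMDiff 𝓘(ℝ, E) (𝓘(ℝ, E).prod 𝓘(ℝ, E →L[ℝ] E)) ∞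
    (fun x ↦ (TotalSpace.mk' (E →L[ℝ] E) x (J x) : TotalSpace (E →L[ℝ] E)
      (fun x : M ↦ TangentSpace 𝓘(ℝ, E) x →L[ℝ] TangentSpace 𝓘(ℝ, E) x)))
  sq : ∀ (x : M) (v : TangentSpace 𝓘(ℝ, E) x), J x (J x v) = -v
  nijenhuis : ∀ X Y : Π x : M, TangentSpace 𝓘(ℝ, E) x, IsSmoothField X → IsSmoothField Y →
    ∀ x : M,
      VectorField.mlieBracket 𝓘(ℝ, E) (fun y ↦ J y (X y)) (fun y ↦ J y (Y y)) x
        - J x (VectorField.mlieBracket 𝓘(ℝ, E) (fun y ↦ J y (X y)) Y x)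
        - J x (VectorField.mlieBracket 𝓘(ℝ, E) X (fun y ↦ J y (Y y)) x)
        - VectorField.mlieBracket 𝓘(ℝ, E) X Y x = 0

/-- Smooth Riemannian metrics on `M`. -/
abbrev RiemMetric (E M : Type*) [NormedAddCommGroup E] [NormedSpace ℝ E]
    [TopologicalSpace M] [ChartedSpace E M] [IsManifold 𝓘(ℝ, E) ∞ M] :=
  ContMDiffRiemannianMetric 𝓘(ℝ, E) ∞ E (fun x : M ↦ TangentSpace 𝓘(ℝ, E) x)

/-- The metric `g` is compatible with `J`: each `J x` is `g`-orthogonal. -/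
def IsCompatible [IsManifold 𝓘(ℝ, E) ∞ M]
    (J : Π x : M, TangentSpace 𝓘(ℝ, E) x →L[ℝ] TangentSpace 𝓘(ℝ, E) x)
    (g : RiemMetric E M) : Prop :=
  ∀ (x : M) (u v : TangentSpace 𝓘(ℝ, E) x), g.inner x (J x u) (J x v) = g.inner x u v

/-- Linear connections on `TM`. For `cov : Connection E M`, the term `cov Y x v` is `∇_v Y` for
`v ∈ T_x M`. -/
abbrev Connection (E M : Type*) [NormedAddCommGroup E] [NormedSpace ℝ E]
    [TopologicalSpace M] [ChartedSpace E M] [IsManifold 𝓘(ℝ, E) ∞ M] :=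
  CovariantDerivative 𝓘(ℝ, E) E (fun x : M ↦ TangentSpace 𝓘(ℝ, E) x)

/-- The vector field `∇_X Y`. -/
noncomputable def nabla [IsManifold 𝓘(ℝ, E) ∞ M] (cov : Connection E M)
    (X Y : Π x : M, TangentSpace 𝓘(ℝ, E) x) : Π x : M, TangentSpace 𝓘(ℝ, E) x :=
  fun x ↦ cov Y x (X x)

/-- The curvature `R(X, Y) Z = ∇_X ∇_Y Z - ∇_Y ∇_X Z - ∇_[X,Y] Z`. -/
noncomputable def curvature [IsManifold 𝓘(ℝ, E) ∞ M] (cov : Connection E M)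
    (X Y Z : Π x : M, TangentSpace 𝓘(ℝ, E) x) : Π x : M, TangentSpace 𝓘(ℝ, E) x :=
  fun x ↦ nabla cov X (nabla cov Y Z) x - nabla cov Y (nabla cov X Z) x
    - nabla cov (VectorField.mlieBracket 𝓘(ℝ, E) X Y) Z x

/-- `∇R = 0`. -/
def HasParallelCurvature [IsManifold 𝓘(ℝ, E) ∞ M] (cov : Connection E M) : Prop :=
  ∀ W X Y Z : Π x : M, TangentSpace 𝓘(ℝ, E) x,
    IsSmoothField W → IsSmoothField X → IsSmoothField Y → IsSmoothField Z → ∀ x : M,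
      nabla cov W (curvature cov X Y Z) x
        - curvature cov (nabla cov W X) Y Z x
        - curvature cov X (nabla cov W Y) Z x
        - curvature cov X Y (nabla cov W Z) x = 0

variable [FiniteDimensional ℝ E] [CompleteSpace E]

/-- The vector field `T(X, Y) = ∇_X Y - ∇_Y X - [X, Y]`, for `T` the torsion tensor. -/
noncomputable def torsionField [IsManifold 𝓘(ℝ, E) ∞ M] (cov : Connection E M)
    (X Y : Π x : M, TangentSpace 𝓘(ℝ, E) x) : Π x : M, TangentSpace 𝓘(ℝ, E) x :=
  fun x ↦ cov.torsion x (X x) (Y x)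

/-- `∇T = 0`. -/
def HasParallelTorsion [IsManifold 𝓘(ℝ, E) ∞ M] (cov : Connection E M) : Prop :=
  ∀ W X Y : Π x : M, TangentSpace 𝓘(ℝ, E) x,
    IsSmoothField W → IsSmoothField X → IsSmoothField Y → ∀ x : M,
      nabla cov W (torsionField cov X Y) x
        - torsionField cov (nabla cov W X) Y x
        - torsionField cov X (nabla cov W Y) x = 0

/-- `cov` is the Bismut connection of `(M, g, J)`: the smooth linear connection that leaves `g` and
`J` parallel and for which `(X, Y, Z) ↦ g (T(X, Y), Z)` is totally skew-symmetric. -/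
structure IsBismut [IsManifold 𝓘(ℝ, E) ∞ M]
    (J : Π x : M, TangentSpace 𝓘(ℝ, E) x →L[ℝ] TangentSpace 𝓘(ℝ, E) x)
    (g : RiemMetric E M) (cov : Connection E M) : Prop where
  smooth : CovariantDerivative.ContMDiffCovariantDerivative cov ∞
  metric : ∀ X Y Z : Π x : M, TangentSpace 𝓘(ℝ, E) x,
    IsSmoothField X → IsSmoothField Y → IsSmoothField Z → ∀ x : M,
      mvfderiv 𝓘(ℝ, E) (fun y ↦ g.inner y (Y y) (Z y)) x (X x)
        = g.inner x (nabla cov X Y x) (Z x) + g.inner x (Y x) (nabla cov X Z x)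
  complex : ∀ X Y : Π x : M, TangentSpace 𝓘(ℝ, E) x, IsSmoothField X → IsSmoothField Y →
    ∀ x : M, nabla cov X (fun y ↦ J y (Y y)) x = J x (nabla cov X Y x)
  skew₁₂ : ∀ (x : M) (u v w : TangentSpace 𝓘(ℝ, E) x),
    g.inner x (cov.torsion x u v) w = -g.inner x (cov.torsion x v u) w
  skew₂₃ : ∀ (x : M) (u v w : TangentSpace 𝓘(ℝ, E) x),
    g.inner x (cov.torsion x u v) w = -g.inner x (cov.torsion x u w) v

/-- Bismut torsion parallel: the Bismut connection has parallel torsion. -/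
def IsBTP [IsManifold 𝓘(ℝ, E) ∞ M]
    (J : Π x : M, TangentSpace 𝓘(ℝ, E) x →L[ℝ] TangentSpace 𝓘(ℝ, E) x)
    (g : RiemMetric E M) : Prop :=
  ∃ cov : Connection E M, IsBismut J g cov ∧ HasParallelTorsion cov

/-- Bismut Ambrose-Singer: the Bismut connection has parallel torsion and parallel curvature. -/
def IsBAS [IsManifold 𝓘(ℝ, E) ∞ M]
    (J : Π x : M, TangentSpace 𝓘(ℝ, E) x →L[ℝ] TangentSpace 𝓘(ℝ, E) x)
    (g : RiemMetric E M) : Prop :=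
  ∃ cov : Connection E M,
    IsBismut J g cov ∧ HasParallelTorsion cov ∧ HasParallelCurvature cov

end Manifold

section LieAlgebra

variable {L : Type*} [LieRing L] [LieAlgebra ℝ L]

/-- The ascending series of `(L, J)`: `a_0 = 0` and
`a_{l+1} = {X : [X, L] ⊆ a_l and [JX, L] ⊆ a_l}`. -/
def ascendingSeries (J : L →ₗ[ℝ] L) : ℕ → Submodule ℝ L
  | 0 => ⊥
  | l + 1 =>
    { carrier := {X | ∀ Y : L, ⁅X, Y⁆ ∈ ascendingSeries J l ∧ ⁅J X, Y⁆ ∈ ascendingSeries J l}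
      add_mem' := fun {X X'} hX hX' Y ↦ by
        simpa only [map_add, add_lie] using
          ⟨add_mem (hX Y).1 (hX' Y).1, add_mem (hX Y).2 (hX' Y).2⟩
      zero_mem' := fun Y ↦ by simp
      smul_mem' := fun c X hX Y ↦ by
        simpa only [map_smul, smul_lie] using
          ⟨Submodule.smul_mem _ c (hX Y).1, Submodule.smul_mem _ c (hX Y).2⟩ }

/-- `J` is nilpotent in the sense of Cordero, Fernandez, Gray and Ugarte. -/
def IsNilpotentJ (J : L →ₗ[ℝ] L) : Prop :=
  ∃ s : ℕ, ascendingSeries J s = ⊤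

end LieAlgebra

section LieGroup

variable {E : Type*} [NormedAddCommGroup E] [NormedSpace ℝ E]
  {G : Type*} [TopologicalSpace G] [ChartedSpace E G] [Group G]

/-- `J` commutes with the differentials of all left translations. -/
def IsLeftInvariantJ
    (J : Π x : G, TangentSpace 𝓘(ℝ, E) x →L[ℝ] TangentSpace 𝓘(ℝ, E) x) : Prop :=
  ∀ (a b : G) (v : TangentSpace 𝓘(ℝ, E) b),
    mfderiv 𝓘(ℝ, E) 𝓘(ℝ, E) (fun x : G ↦ a * x) b (J b v)
      = J (a * b) (mfderiv 𝓘(ℝ, E) 𝓘(ℝ, E) (fun x : G ↦ a * x) b v)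

/-- All left translations are isometries of `g`. -/
def IsLeftInvariantMetric [IsManifold 𝓘(ℝ, E) ∞ G] (g : RiemMetric E G) : Prop :=
  ∀ (a b : G) (u v : TangentSpace 𝓘(ℝ, E) b),
    g.inner (a * b) (mfderiv 𝓘(ℝ, E) 𝓘(ℝ, E) (fun x : G ↦ a * x) b u)
      (mfderiv 𝓘(ℝ, E) 𝓘(ℝ, E) (fun x : G ↦ a * x) b v) = g.inner b u v

/-- The endomorphism of the Lie algebra of `G` given by `J` at the identity. -/
def endAtOne (J : Π x : G, TangentSpace 𝓘(ℝ, E) x →L[ℝ] TangentSpace 𝓘(ℝ, E) x) :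
    GroupLieAlgebra 𝓘(ℝ, E) G →ₗ[ℝ] GroupLieAlgebra 𝓘(ℝ, E) G :=
  (J 1).toLinearMap

end LieGroup

end BismutNil

/-! The Bismut connection of invariant data is itself invariant (`nabla_inv`), so everything becomes
algebra on the Lie algebra: a bilinear map `A` with `A w` skew, commuting with `J`, and with totally
skew parallel torsion `T`.

Let Z be `complexCenter`, the largest `J`-invariant subspace of the centre. The key fact is
`A_center`: elements of Z are parallel. Hence the orthogonal complement of Z is parallel too, the
structure descends to the quotient by Z, and for x in Z the operator `A x` encodes the x-component
of the bracket and commutes with every `A w`. If the quotient is two-step with commutators in its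
own `J`-invariant centre, positivity of the metric forces those commutators to vanish
(`br_mem_center_of_quotient`). Induction along the ascending series then gives [V, V] ⊆ Z
(`br_mem_center`).

Once [V, V] ⊆ Z, a type argument gives `A w = 0` for w orthogonal to Z (`A_of_mem_perp`). So all `A
w` commute, the curvature is R(x, y) = -A_[x,y], and ∇R = 0 follows from ∇T = 0 (`A_br_derivation`).
Since ∇R is a tensor, checking it on an invariant frame is enough (`hasParallelCurvature_of_frame`).
-/

namespace BismutNil

/-! ### Parallelism of the `J`-invariant centre -/

section Algebra

universe u

/-- A Lie bracket `br`, a positive definite form `B`, an orthogonal complex structure `J` and a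
left-invariant connection `A` that leaves `B` and `J` parallel and whose torsion is totally
skew-symmetric and parallel. -/
structure ParallelSkewTorsion (V : Type u) [AddCommGroup V] [Module ℝ V] where
  br : V →ₗ[ℝ] V →ₗ[ℝ] V
  A : V →ₗ[ℝ] V →ₗ[ℝ] V
  J : V →ₗ[ℝ] V
  B : V →ₗ[ℝ] V →ₗ[ℝ] ℝ
  T : V → V → V
  T_def : ∀ x y, T x y = A x y - A y x - br x y
  br_skew : ∀ x y, br x y = -br y x
  jacobi : ∀ x y z, br x (br y z) = br (br x y) z + br y (br x z)
  B_symm : ∀ x y, B x y = B y x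
  B_pos : ∀ x, x ≠ 0 → 0 < B x x
  J_sq : ∀ x, J (J x) = -x
  B_J : ∀ x y, B (J x) (J y) = B x y
  A_skew : ∀ x y z, B (A x y) z = -B (A x z) y
  A_J : ∀ x y, A x (J y) = J (A x y)
  T_skew : ∀ x y z, B (T x y) z = -B (T x z) y
  parallel : ∀ w x y, A w (T x y) = T (A w x) y + T x (A w y)

namespace ParallelSkewTorsion

variable {V : Type u} [AddCommGroup V] [Module ℝ V] (D : ParallelSkewTorsion V)

lemma eq_zero_of_B_self {x : V} (h : D.B x x = 0) : x = 0 := by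
  by_contra hx
  exact (D.B_pos x hx).ne' h

lemma eq_of_forall_B {x y : V} (h : ∀ u, D.B x u = D.B y u) : x = y := by
  refine sub_eq_zero.1 (D.eq_zero_of_B_self ?_)
  rw [LinearMap.map_sub₂, h, sub_self]

lemma B_J_left (x y : V) : D.B (D.J x) y = -D.B x (D.J y) := by
  have h := D.B_J x (D.J y)
  rw [D.J_sq, map_neg] at h
  linarith

lemma T_swap (x y : V) : D.T x y = -D.T y x := by
  rw [D.T_def, D.T_def, D.br_skew x y]
  abel

lemma J_injective {x : V} (h : D.J x = 0) : x = 0 := by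
  have := D.J_sq x
  rw [h, map_zero] at this
  exact neg_eq_zero.1 this.symm

/-- The largest `J`-invariant subspace of the centre. -/
def complexCenter : Submodule ℝ V where
  carrier := {x | ∀ y, D.br x y = 0 ∧ D.br (D.J x) y = 0}
  add_mem' := fun {x x'} hx hx' y ↦ by simp [(hx y).1, (hx y).2, (hx' y).1, (hx' y).2]
  zero_mem' := fun y ↦ by simp
  smul_mem' := fun c x hx y ↦ by simp [(hx y).1, (hx y).2]

variable {D}

lemma br_center_left {x : V} (hx : x ∈ D.complexCenter) (y : V) : D.br x y = 0 := (hx y).1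

lemma br_center_right {x : V} (hx : x ∈ D.complexCenter) (y : V) : D.br y x = 0 := by
  rw [D.br_skew, br_center_left hx, neg_zero]

lemma J_mem_center {x : V} (hx : x ∈ D.complexCenter) : D.J x ∈ D.complexCenter := fun y ↦
  ⟨(hx y).2, by rw [D.J_sq, map_neg, LinearMap.neg_apply, (hx y).1, neg_zero]⟩

/-- Koszul-type computation: both brackets with x vanish, and skewness of the torsion and of `A`
eliminates every other term. -/
lemma B_A_center {x : V} (hx : x ∈ D.complexCenter) (y u : V) :
    D.B (D.A y x) u = -D.B (D.A x y) u - D.B (D.br y u) x := by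
  have e (a b c : V) : D.B (D.T a b) c = D.B (D.A a b) c - D.B (D.A b a) c - D.B (D.br a b) c := by
    rw [D.T_def]; simp
  have h1 := e x y u
  have h2 := e x u y
  have h3 := e y u x
  have h4 := D.T_skew x y u
  have h5 := D.T_skew y u x
  have h6 : D.B (D.T y x) u = -D.B (D.T x y) u := by rw [D.T_swap]; simp
  have h7 := D.A_skew y u x
  have h8 := D.A_skew u y x
  have h9 := D.A_skew x y u
  rw [br_center_left hx, map_zero, LinearMap.zero_apply] at h1 h2
  linarith

lemma B_A_center_skew {x : V} (hx : x ∈ D.complexCenter) (y u : V) :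
    D.B (D.A y x) u = -D.B (D.A u x) y := by
  have h1 := B_A_center hx y u
  have h2 := B_A_center hx u y
  have h3 := D.A_skew x y u
  rw [D.br_skew u y] at h2
  simp only [map_neg, LinearMap.neg_apply] at h2
  linarith

/-- The form (y, u) ↦ B(A_y x, u) is skew for x and also for `J x`, while `A` commutes with `J`;
comparing the two makes u ↦ A_u x antilinear. -/
lemma A_J_center {x : V} (hx : x ∈ D.complexCenter) (u : V) :
    D.A (D.J u) x = -D.J (D.A u x) := by
  refine D.eq_of_forall_B fun y ↦ ?_
  have h1 := B_A_center_skew (J_mem_center hx) y u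
  rw [D.A_J, D.A_J, B_J_left, B_A_center_skew hx y (D.J u)] at h1
  rw [map_neg, LinearMap.neg_apply]
  linarith

/-- On the centre `A` is skew in its two arguments, so complex linearity in the second would carry
over to the first, where `A_J_center` gives antilinearity. -/
lemma A_center_center {x y : V} (hx : x ∈ D.complexCenter) (hy : y ∈ D.complexCenter) :
    D.A x y = 0 := by
  have swap {x y : V} (hx : x ∈ D.complexCenter) (hy : y ∈ D.complexCenter) :
      D.A x y = -D.A y x := by
    refine D.eq_of_forall_B fun u ↦ ?_
    rw [B_A_center hy, br_center_left hx]
    simp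
  have h1 := A_J_center hy x
  rw [swap (J_mem_center hx) hy, D.A_J, swap hy hx, map_neg, neg_neg] at h1
  exact D.J_injective (by
    have : (2 : ℝ) • D.J (D.A x y) = 0 := by rw [two_smul]; nth_rw 1 [h1]; abel
    exact (smul_eq_zero.1 this).resolve_left two_ne_zero)

/-- Elements of the `J`-invariant centre are parallel. -/
theorem A_center {x : V} (hx : x ∈ D.complexCenter) (w : V) : D.A w x = 0 := by
  -- Parallelism of T evaluated on the pair (x, Jx), where T(x, Jx) = 0.
  have key (w : V) : (2 : ℝ) • D.J (D.A (D.A w x) x)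
      = D.A (D.J x) (D.A w x) - D.J (D.A x (D.A w x)) := by
    have h := D.parallel w x (D.J x)
    have hJ := J_mem_center hx
    rw [D.T_def x, A_center_center hx hJ, A_center_center hJ hx, br_center_left hx,
      D.T_swap _ (D.J x), D.A_J w, D.T_def, D.T_def, br_center_left hx, br_center_left hJ,
      A_J_center hx, D.A_J, D.A_J] at h
    simp only [sub_zero, map_zero, sub_neg_eq_add] at h
    rw [two_smul]
    have h' := sub_eq_zero.2 h
    rw [← sub_eq_zero, ← neg_eq_zero, ← h']
    abel
  -- With v = A_w x, the left side of `key` is antilinear in v and the right side linear. Replacing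
  -- w by Jw replaces v by -Jv, so both sides vanish.
  have h0 : D.A (D.A w x) x = 0 := by
    have h1 := key w
    have h2 := key (D.J w)
    rw [A_J_center hx w] at h2
    simp only [map_neg, LinearMap.neg_apply, A_J_center hx, D.A_J, D.J_sq, neg_neg] at h2
    have h3 := congrArg D.J h1
    simp only [map_smul, map_sub, D.J_sq] at h3
    have h4 : (4 : ℝ) • D.A (D.A w x) x = 0 := by
      have h5 := congrArg₂ (· + ·) h2 h3
      have : (4 : ℝ) • D.A (D.A w x) x
          = -((2 : ℝ) • -D.A (D.A w x) x + (2 : ℝ) • -D.A (D.A w x) x) := by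
        module
      rw [this]
      rw [h5]
      abel
    exact (smul_eq_zero.1 h4).resolve_left (by norm_num)
  refine D.eq_zero_of_B_self ?_
  have := B_A_center_skew hx w (D.A w x)
  rwa [h0, map_zero, LinearMap.zero_apply, neg_zero] at this

/-- For such x the torsion reduces to T(x, v) = A_x v, so this is exactly ∇T = 0. -/
lemma A_comm_of_center {x : V} (hx : x ∈ D.complexCenter) (w v : V) :
    D.A w (D.A x v) = D.A x (D.A w v) := by
  have h := D.parallel w x v
  simp only [D.T_def, A_center hx, br_center_left hx, map_zero, sub_zero, LinearMap.zero_apply,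
    zero_add] at h
  exact h

lemma B_A_of_center {x : V} (hx : x ∈ D.complexCenter) (y u : V) :
    D.B (D.A x y) u = -D.B (D.br y u) x := by
  have := B_A_center hx y u
  rw [A_center hx, map_zero, LinearMap.zero_apply] at this
  linarith

end ParallelSkewTorsion

end Algebra

/-! ### Quotient by the `J`-invariant centre, and reduction to the two-step case -/

section Quotient

universe u

namespace ParallelSkewTorsion

variable {V : Type u} [AddCommGroup V] [Module ℝ V] (D : ParallelSkewTorsion V)

/-- The orthogonal complement of the `J`-invariant centre. -/
def perp : Submodule ℝ V := LinearMap.BilinForm.orthogonal D.B D.complexCenter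

variable {D}

/-- The centre Z is parallel and the connection is metric; in fact all values of `A` are orthogonal
to Z. -/
lemma A_mem_perp (w x : V) : D.A w x ∈ D.perp := fun z hz ↦ by
  change D.B z (D.A w x) = 0
  rw [D.B_symm, D.A_skew, A_center hz, map_zero, LinearMap.zero_apply, neg_zero]

lemma J_mem_perp {x : V} (hx : x ∈ D.perp) : D.J x ∈ D.perp := fun z hz ↦ by
  have h := B_J_left (D := D) z x
  have h' : D.B (D.J z) x = 0 := hx _ (J_mem_center hz)
  change D.B z (D.J x) = 0
  linarith

lemma eq_zero_of_mem_center_of_mem_perp {x : V} (hx : x ∈ D.complexCenter) (hx' : x ∈ D.perp) :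
    x = 0 :=
  D.eq_zero_of_B_self (hx' x hx)

variable [FiniteDimensional ℝ V]

variable (D) in
lemma isCompl_perp : IsCompl D.perp D.complexCenter := by
  have hr : LinearMap.IsRefl D.B := fun x y h ↦ by rw [D.B_symm, h]
  refine ((LinearMap.BilinForm.isCompl_orthogonal_iff_disjoint hr).2 ?_).symm
  rw [Submodule.disjoint_def]
  exact fun x hx hx' ↦ eq_zero_of_mem_center_of_mem_perp hx hx'

variable (D) in
/-- The orthogonal projection onto the complement of the `J`-invariant centre. -/
noncomputable def proj : V →ₗ[ℝ] D.perp :=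
  Submodule.projectionOnto D.perp D.complexCenter D.isCompl_perp

lemma sub_proj_mem (x : V) : x - D.proj x ∈ D.complexCenter :=
  Submodule.sub_projection_mem D.isCompl_perp x

lemma proj_of_mem {x : V} (hx : x ∈ D.perp) : (D.proj x : V) = x := by
  have := Submodule.projectionOnto_apply_of_mem_left D.isCompl_perp hx
  exact congrArg Subtype.val this

lemma proj_eq_zero_iff {x : V} : D.proj x = 0 ↔ x ∈ D.complexCenter :=
  Submodule.projectionOnto_apply_eq_zero_iff D.isCompl_perp

lemma br_proj_left (x y : V) : D.br (D.proj x) y = D.br x y := by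
  have := br_center_left (sub_proj_mem (D := D) x) y
  rw [map_sub, LinearMap.sub_apply] at this
  exact (sub_eq_zero.1 this).symm

lemma br_proj_right (x y : V) : D.br x (D.proj y) = D.br x y := by
  rw [D.br_skew, br_proj_left, ← D.br_skew]

lemma A_proj_right (x y : V) : D.A x (D.proj y) = D.A x y := by
  have := A_center (sub_proj_mem (D := D) y) x
  rw [map_sub] at this
  exact (sub_eq_zero.1 this).symm

lemma B_proj_left (x : V) (y : D.perp) : D.B (D.proj x) y = D.B x y := by
  have : D.B (x - D.proj x) y = 0 := y.2 _ (sub_proj_mem x)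
  rw [LinearMap.map_sub₂] at this
  exact (sub_eq_zero.1 this).symm

lemma coe_proj_A (x y : V) : (D.proj (D.A x y) : V) = D.A x y := proj_of_mem (A_mem_perp x y)

variable (D) in
/-- The structure induced on the quotient by the `J`-invariant centre, realised on the orthogonal
complement. -/
noncomputable def quotient : ParallelSkewTorsion D.perp where
  br := (D.br.domRestrict₁₂ D.perp D.perp).compr₂ D.proj
  A := (D.A.domRestrict₁₂ D.perp D.perp).compr₂ D.proj
  J := D.proj ∘ₗ D.J ∘ₗ D.perp.subtype
  B := D.B.domRestrict₁₂ D.perp D.perp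
  T x y := D.proj (D.T x y)
  T_def x y := by simp [LinearMap.domRestrict₁₂_apply, D.T_def]
  br_skew x y := by simp [LinearMap.domRestrict₁₂_apply, D.br_skew x y]
  jacobi x y z := by
    simp [LinearMap.domRestrict₁₂_apply, br_proj_left, br_proj_right, D.jacobi x y z]
  B_symm x y := D.B_symm x y
  B_pos x hx := D.B_pos x (by simpa using hx)
  J_sq x := by
    ext
    simp [proj_of_mem (J_mem_perp x.2), D.J_sq, proj_of_mem x.2]
  B_J x y := by
    simp [LinearMap.domRestrict₁₂_apply, proj_of_mem (J_mem_perp x.2),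
      proj_of_mem (J_mem_perp y.2), D.B_J]
  A_skew x y z := by simp [LinearMap.domRestrict₁₂_apply, B_proj_left, D.A_skew x y z]
  A_J x y := by
    ext
    simp [LinearMap.domRestrict₁₂_apply, proj_of_mem (J_mem_perp y.2), coe_proj_A, D.A_J]
  T_skew x y z := by simp [LinearMap.domRestrict₁₂_apply, B_proj_left, D.T_skew x y z]
  parallel w x y := by
    simp [LinearMap.domRestrict₁₂_apply, A_proj_right, coe_proj_A, D.parallel w x y]

lemma quotient_br (x y : D.perp) : D.quotient.br x y = D.proj (D.br x y) := rfl

lemma coe_quotient_A (x y : D.perp) : (D.quotient.A x y : V) = D.A x y := coe_proj_A _ _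

lemma coe_quotient_J (x : D.perp) : (D.quotient.J x : V) = D.J x := proj_of_mem (J_mem_perp x.2)

lemma br_mem_center_of_mem_quotient_center {x : D.perp} (hx : x ∈ D.quotient.complexCenter)
    (y : V) : D.br x y ∈ D.complexCenter := by
  have := (hx (D.proj y)).1
  rwa [quotient_br, br_proj_right, proj_eq_zero_iff] at this

/-- Bracketing with x lands in the centre, so the other two terms of the Jacobi identity vanish. -/
lemma br_br_quotient_center {x : D.perp} (hx : x ∈ D.quotient.complexCenter) (u v : V) :
    D.br (D.br u v) x = 0 := by
  have h := D.jacobi u v x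
  have hx' (y : V) : D.br y x ∈ D.complexCenter := by
    rw [D.br_skew]
    exact neg_mem (br_mem_center_of_mem_quotient_center hx y)
  rw [br_center_right (hx' v), br_center_right (hx' u), add_zero] at h
  exact h.symm

/-- If the quotient by the `J`-invariant centre is two-step, then its commutators vanish. -/
lemma br_mem_center_of_quotient
    (h : ∀ x y, D.quotient.br x y ∈ D.quotient.complexCenter) (x y : V) :
    D.br x y ∈ D.complexCenter := by
  -- `A w` preserves the centre of the quotient: elements v there are parallel in the quotient and
  -- `A w` commutes with all `A x'`, so A_{x'} (A_w v) = 0. For x' = [A_w v, u], `B_A_of_center`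
  -- turns this into the vanishing of the squared norm of x'.
  have hA {w : V} (hw : w ∈ D.complexCenter) {v : D.perp} (hv : v ∈ D.quotient.complexCenter) :
      (⟨D.A w v, A_mem_perp _ _⟩ : D.perp) ∈ D.quotient.complexCenter := by
    have hbr {v : D.perp} (hv : v ∈ D.quotient.complexCenter) (u : D.perp) :
        D.quotient.br ⟨D.A w v, A_mem_perp _ _⟩ u = 0 := by
      set q : D.perp := ⟨D.A w v, A_mem_perp _ _⟩ with hq
      have hz {x' : D.perp} (hx' : x' ∈ D.quotient.complexCenter) : D.quotient.A x' q = 0 := by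
        ext
        have h0 := congrArg (Subtype.val) (A_center hv x')
        rw [coe_quotient_A] at h0 ⊢
        change D.A x' (D.A w v) = 0
        rw [A_comm_of_center hw, h0]
        simp
      have h1 := B_A_of_center (h q u) q u
      rw [hz (h q u), map_zero, LinearMap.zero_apply] at h1
      exact D.quotient.eq_zero_of_B_self (neg_eq_zero.1 h1.symm)
    refine fun u ↦ ⟨hbr hv u, ?_⟩
    have hJ : D.quotient.J ⟨D.A w v, A_mem_perp _ _⟩
        = ⟨D.A w (D.quotient.J v), A_mem_perp _ _⟩ := by
      ext
      rw [coe_quotient_J]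
      change D.J (D.A w v) = D.A w (D.quotient.J v)
      rw [coe_quotient_J, D.A_J]
    rw [hJ]
    exact hbr (J_mem_center hv) u
  rw [← br_proj_left, ← br_proj_right]
  generalize D.proj x = x', D.proj y = y'
  set v := D.quotient.br x' y' with hv
  have hvc : v ∈ D.quotient.complexCenter := h x' y'
  -- Here v must be a commutator: |A_w v|² = -B([v, A_w v], w), and commutators commute with `A w
  -- v`, which is central in the quotient.
  have hA0 {w : V} (hw : w ∈ D.complexCenter) : D.A w v = 0 := by
    refine D.eq_zero_of_B_self ?_
    have := B_A_of_center hw v (D.A w v)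
    rwa [hv, quotient_br, br_proj_left, ← quotient_br, ← hv, br_br_quotient_center (hA hw hvc),
      map_zero, LinearMap.zero_apply, neg_zero] at this
  -- Now w = [v, u] is itself in the centre, and |w|² = -B(A_w v, u).
  have hbr0 {v : D.perp} (hv : v ∈ D.quotient.complexCenter)
      (hA0 : ∀ w ∈ D.complexCenter, D.A w v = 0) (u : V) : D.br v u = 0 := by
    have hm := br_mem_center_of_mem_quotient_center hv u
    have := B_A_of_center hm v u
    rw [hA0 _ hm, map_zero, LinearMap.zero_apply] at this
    exact D.eq_zero_of_B_self (neg_eq_zero.1 this.symm)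
  have hvZ : (v : V) ∈ D.complexCenter := fun u ↦ by
    refine ⟨hbr0 hvc (fun w hw ↦ hA0 hw) u, ?_⟩
    rw [← coe_quotient_J]
    refine hbr0 (J_mem_center hvc) (fun w hw ↦ ?_) u
    rw [coe_quotient_J, D.A_J, hA0 hw, map_zero]
  rw [← proj_eq_zero_iff, ← quotient_br, ← hv]
  exact Subtype.ext (eq_zero_of_mem_center_of_mem_perp hvZ v.2)

/-- The series is an arbitrary one with the descent property, so that its image in the quotient can
be used without identifying it with the ascending series there. -/
theorem br_mem_center : ∀ (n : ℕ) {V : Type u} [AddCommGroup V] [Module ℝ V]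
    [FiniteDimensional ℝ V] (D : ParallelSkewTorsion V) (a : ℕ → Submodule ℝ V),
    a 0 = ⊥ → a n = ⊤ → (∀ l, ∀ x ∈ a (l + 1), ∀ y, D.br x y ∈ a l ∧ D.br (D.J x) y ∈ a l) →
    ∀ x y, D.br x y ∈ D.complexCenter := by
  intro n
  induction n with
  | zero =>
    intro V _ _ _ D a h0 hn _ x y
    have hx : x ∈ a 0 := hn ▸ Submodule.mem_top
    rw [h0, Submodule.mem_bot] at hx
    rw [hx, map_zero, LinearMap.zero_apply]
    exact zero_mem _
  | succ n ih =>
    intro V _ _ _ D a h0 hn ha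
    have ha1 {x : V} (hx : x ∈ a 1) : x ∈ D.complexCenter := fun y ↦ by
      simpa [h0] using ha 0 x hx y
    -- The index shifts by one because `a 1` lies in the `J`-invariant centre and projects to zero.
    refine br_mem_center_of_quotient
      (ih D.quotient (fun l ↦ (a (l + 1)).map D.proj) ?_ ?_ ?_)
    · rw [eq_bot_iff]
      rintro _ ⟨x, hx, rfl⟩
      exact proj_eq_zero_iff.2 (ha1 hx)
    · simp only [hn, Submodule.map_top]
      exact Submodule.range_projectionOnto D.isCompl_perp
    · rintro l _ ⟨x, hx, rfl⟩ y
      refine ⟨⟨D.br x y, (ha _ x hx y).1, ?_⟩, ⟨D.br (D.J x) y, (ha _ x hx y).2, ?_⟩⟩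
      · rw [quotient_br, br_proj_left]
      · rw [quotient_br, coe_quotient_J]
        have := (sub_proj_mem (D := D) x y).2
        rw [map_sub, map_sub, LinearMap.sub_apply, sub_eq_zero] at this
        rw [this]

/-! ### The connection when all commutators lie in the `J`-invariant centre -/

section TwoStep

variable (h : ∀ x y, D.br x y ∈ D.complexCenter)

include h

/-- Restricted to the complement, c(x, y, z) = B(A_x y, z) does not see the bracket, so skew torsion
makes it a 3-form. It is `J`-invariant in every pair of arguments, and such a form is zero: c(x,y,z)
= c(Jx,Jy,z) = -c(Jx,y,Jz) = -c(x,y,z). -/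
lemma A_of_mem_perp {w : V} (hw : w ∈ D.perp) : D.A w = 0 := by
  have hB {x y z : V} (hz : z ∈ D.perp) : D.B (D.br x y) z = 0 := hz _ (h x y)
  have cyc {x y z : V} (hz : z ∈ D.perp) :
      D.B (D.T x y) z = D.B (D.A x y) z - D.B (D.A y x) z := by
    rw [D.T_def, map_sub, map_sub, LinearMap.sub_apply, LinearMap.sub_apply, hB hz, sub_zero]
  have rot {x y z : V} (hx : x ∈ D.perp) (hy : y ∈ D.perp) (hz : z ∈ D.perp) :
      D.B (D.A x y) z = D.B (D.A y z) x := by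
    have e1 := cyc (x := x) (y := y) hz
    have e2 := cyc (x := y) (y := z) hx
    have e3 := cyc (x := z) (y := x) hy
    have t1 := D.T_skew x y z
    have t2 := D.T_skew y z x
    have t3 : D.B (D.T x z) y = -D.B (D.T z x) y := by rw [D.T_swap]; simp
    have t4 : D.B (D.T y x) z = -D.B (D.T x y) z := by rw [D.T_swap]; simp
    have s1 := D.A_skew x y z
    have s2 := D.A_skew y z x
    have s3 := D.A_skew z x y
    linarith
  have hJ {x y z : V} : D.B (D.A x (D.J y)) (D.J z) = D.B (D.A x y) z := by
    rw [D.A_J, D.B_J]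
  have hperp {x y z : V} (hx : x ∈ D.perp) (hy : y ∈ D.perp) (hz : z ∈ D.perp) :
      D.B (D.A x y) z = 0 := by
    have Jx := J_mem_perp hx
    have Jy := J_mem_perp hy
    have Jz := J_mem_perp hz
    have r1 := rot Jx Jy hz
    have r2 := rot hy hz hx
    have r2' := rot hz hx hy
    have r3 := rot Jx hy Jz
    have a1 : D.B (D.A (D.J y) z) (D.J x) = D.B (D.A (D.J x) (D.J y)) z := r1.symm
    have j1 : D.B (D.A z (D.J x)) (D.J y) = D.B (D.A z x) y := hJ
    have j2 : D.B (D.A y (D.J z)) (D.J x) = D.B (D.A y z) x := hJ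
    have j3 : D.B (D.A (D.J x) (D.J y)) z = -D.B (D.A (D.J x) y) (D.J z) := by
      rw [D.A_J, B_J_left]
    have r4 := rot (Jy) hz Jx
    linarith
  ext y
  refine D.eq_zero_of_B_self ?_
  rw [← A_proj_right]
  exact hperp hw (D.proj y).2 (A_mem_perp _ _)

lemma A_A_left (w x : V) : D.A (D.A w x) = 0 := A_of_mem_perp h (A_mem_perp w x)

/-- Only the central component of x contributes to `A x`. -/
lemma A_comm (w x v : V) : D.A w (D.A x v) = D.A x (D.A w v) := by
  have : D.A x = D.A (x - D.proj x) := by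
    rw [map_sub, A_of_mem_perp h (D.proj x).2, sub_zero]
  rw [this, A_comm_of_center (sub_proj_mem x)]

/-- `A` annihilates its own values, so A_[a,b] = -A_{T(a,b)}, and applying `A` to ∇T = 0 leaves this
identity. It is the part of ∇R = 0 coming from differentiating the two form arguments of R. -/
lemma A_br_derivation (w x y : V) :
    D.A (D.br (D.A w x) y) = -D.A (D.br x (D.A w y)) := by
  have e (a b : V) : D.br a b = D.A a b - D.A b a - D.T a b := by rw [D.T_def]; abel
  have p := D.parallel w x y
  rw [← sub_eq_zero] at p
  have hT : D.T x (D.A w y) = D.A w (D.T x y) - D.T (D.A w x) y := by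
    rw [D.parallel w x y]; abel
  rw [e, e x, hT]
  simp only [map_sub, A_A_left h, LinearMap.zero_apply, map_zero]
  abel

end TwoStep

end ParallelSkewTorsion

end Quotient

/-! ### Tensoriality of R and ∇R over smooth functions -/

section Tensoriality

variable {E : Type*} [NormedAddCommGroup E] [NormedSpace ℝ E]
  {M : Type*} [TopologicalSpace M] [ChartedSpace E M] [IsManifold 𝓘(ℝ, E) ∞ M]

namespace IsSmoothField

variable {X Y : Π x : M, TangentSpace 𝓘(ℝ, E) x} {f : M → ℝ}

lemma mdifferentiableAt (hX : IsSmoothField X) (x : M) :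
    MDifferentiableAt 𝓘(ℝ, E) 𝓘(ℝ, E).tangent
      (fun y ↦ (⟨y, X y⟩ : TangentBundle 𝓘(ℝ, E) M)) x :=
  (hX x).mdifferentiableAt (by simp)

lemma zero : IsSmoothField (0 : Π x : M, TangentSpace 𝓘(ℝ, E) x) :=
  Bundle.contMDiff_zeroSection ℝ (fun x : M ↦ TangentSpace 𝓘(ℝ, E) x)

lemma add (hX : IsSmoothField X) (hY : IsSmoothField Y) : IsSmoothField (X + Y) :=
  ContMDiff.add_section hX hY

lemma smul (hf : ContMDiff 𝓘(ℝ, E) 𝓘(ℝ, ℝ) ∞ f) (hX : IsSmoothField X) :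
    IsSmoothField (f • X) :=
  ContMDiff.smul_section hf hX

lemma nabla {cov : Connection E M} (hcov : CovariantDerivative.ContMDiffCovariantDerivative cov ∞)
    (hX : IsSmoothField X) (hY : IsSmoothField Y) : IsSmoothField (nabla cov X Y) := by
  have h := hcov.contMDiff.contMDiff (σ := Y) hY.contMDiffOn
  rw [contMDiffOn_univ] at h
  exact ContMDiff.clm_bundle_apply h hX

lemma mlieBracket [CompleteSpace E] (hX : IsSmoothField X) (hY : IsSmoothField Y) :
    IsSmoothField (VectorField.mlieBracket 𝓘(ℝ, E) X Y) := by
  have : IsManifold 𝓘(ℝ, E) (((⊤ : ℕ∞) : ℕ∞ω) + 1) M := ‹IsManifold 𝓘(ℝ, E) ∞ M›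
  intro x
  refine ContMDiffAt.mlieBracket_vectorField (m := ⊤) (n := ⊤) (hX x) (hY x) ?_
  simp

lemma mvfderiv_apply (hf : ContMDiff 𝓘(ℝ, E) 𝓘(ℝ, ℝ) ∞ f) (hX : IsSmoothField X) :
    ContMDiff 𝓘(ℝ, E) 𝓘(ℝ, ℝ) ∞ (fun x ↦ mvfderiv 𝓘(ℝ, E) f x (X x)) := by
  have h1 : ContMDiff 𝓘(ℝ, E).tangent 𝓘(ℝ, ℝ).tangent ∞ (tangentMap 𝓘(ℝ, E) 𝓘(ℝ, ℝ) f) :=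
    hf.contMDiff_tangentMap (by simp)
  have h2 := contMDiff_snd_tangentBundle_modelSpace (n := ∞) ℝ 𝓘(ℝ, ℝ)
  exact h2.comp (h1.comp hX)

lemma inner {g : RiemMetric E M} (hX : IsSmoothField X) (hY : IsSmoothField Y) :
    ContMDiff 𝓘(ℝ, E) 𝓘(ℝ, ℝ) ∞ (fun x ↦ g.inner x (X x) (Y x)) := by
  have h := ContMDiff.clm_bundle_apply₂ (F₁ := E) (F₂ := E) (F₃ := ℝ) g.contMDiff hX hY
  intro x
  exact (contMDiffAt_totalSpace.1 (h x)).2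

end IsSmoothField

/-- A map on smooth fields that is additive, homogeneous over smooth functions, and kills the
members of a global frame vanishes. -/
lemma eq_zero_of_frame {ι : Type*} [Fintype ι] {e : ι → Π x : M, TangentSpace 𝓘(ℝ, E) x}
    (he : ∀ i, IsSmoothField (e i)) {A : Type*} [AddCommGroup A] [Module ℝ A] {x : M}
    (Φ : (Π x : M, TangentSpace 𝓘(ℝ, E) x) → A)
    (hadd : ∀ X Y, IsSmoothField X → IsSmoothField Y → Φ (X + Y) = Φ X + Φ Y)
    (hsmul : ∀ (f : M → ℝ) X, ContMDiff 𝓘(ℝ, E) 𝓘(ℝ, ℝ) ∞ f → IsSmoothField X →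
      Φ (f • X) = f x • Φ X)
    (hzero : ∀ i, Φ (e i) = 0) {X : Π x : M, TangentSpace 𝓘(ℝ, E) x} {c : ι → M → ℝ}
    (hc : ∀ i, ContMDiff 𝓘(ℝ, E) 𝓘(ℝ, ℝ) ∞ (c i)) (hX : X = ∑ i, c i • e i) : Φ X = 0 := by
  classical
  have key (s : Finset ι) : IsSmoothField (∑ i ∈ s, c i • e i) ∧ Φ (∑ i ∈ s, c i • e i) = 0 := by
    induction s using Finset.induction_on with
    | empty =>
      refine ⟨by simpa using IsSmoothField.zero, ?_⟩
      have := hsmul (fun _ ↦ 0) 0 contMDiff_const IsSmoothField.zero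
      rw [zero_smul] at this
      rw [Finset.sum_empty, ← this]
      congr 1
      exact (smul_zero _).symm
    | insert i s hi ih =>
      rw [Finset.sum_insert hi]
      have hs := (he i).smul (hc i)
      exact ⟨hs.add ih.1, by rw [hadd _ _ hs ih.1, hsmul _ _ (hc i) (he i), hzero, ih.2]; simp⟩
  rw [hX]
  exact (key Finset.univ).2

variable {cov : Connection E M} {W X X' Y Y' Z Z' : Π x : M, TangentSpace 𝓘(ℝ, E) x} {f : M → ℝ}

lemma nabla_add_left : nabla cov (X + X') Y = nabla cov X Y + nabla cov X' Y := by
  ext x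
  exact map_add _ _ _

lemma nabla_smul_left : nabla cov (f • X) Y = f • nabla cov X Y := by
  ext x
  exact map_smul _ _ _

lemma nabla_add_right (hY : IsSmoothField Y) (hY' : IsSmoothField Y') :
    nabla cov X (Y + Y') = nabla cov X Y + nabla cov X Y' := by
  ext x
  have := cov.isCovariantDerivativeOnUniv.add (hY.mdifferentiableAt x) (hY'.mdifferentiableAt x)
  exact congrArg (fun L ↦ L (X x)) this

lemma nabla_smul_right (hf : ContMDiff 𝓘(ℝ, E) 𝓘(ℝ, ℝ) ∞ f) (hY : IsSmoothField Y) :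
    nabla cov X (f • Y)
      = f • nabla cov X Y + (fun x ↦ mvfderiv 𝓘(ℝ, E) f x (X x)) • Y := by
  ext x
  have := cov.isCovariantDerivativeOnUniv.leibniz (hY.mdifferentiableAt x)
    ((hf x).mdifferentiableAt (by simp))
  exact congrArg (fun L ↦ L (X x)) this

lemma curvature_def (cov : Connection E M) (X Y Z : Π x : M, TangentSpace 𝓘(ℝ, E) x) :
    curvature cov X Y Z = nabla cov X (nabla cov Y Z) - nabla cov Y (nabla cov X Z)
      - nabla cov (VectorField.mlieBracket 𝓘(ℝ, E) X Y) Z := rfl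

lemma curvature_swap : curvature cov X Y Z = -curvature cov Y X Z := by
  rw [curvature_def, curvature_def, VectorField.mlieBracket_swap (V := Y)]
  have : nabla cov (-VectorField.mlieBracket 𝓘(ℝ, E) X Y) Z
      = -nabla cov (VectorField.mlieBracket 𝓘(ℝ, E) X Y) Z := by
    ext x
    exact map_neg _ _
  rw [this]
  abel

variable [CompleteSpace E]

section

variable (hcov : CovariantDerivative.ContMDiffCovariantDerivative cov ∞)

include hcov

lemma isSmoothField_curvature (hX : IsSmoothField X) (hY : IsSmoothField Y)
    (hZ : IsSmoothField Z) : IsSmoothField (curvature cov X Y Z) := by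
  have sub {X Y : Π x : M, TangentSpace 𝓘(ℝ, E) x} (hX : IsSmoothField X)
      (hY : IsSmoothField Y) : IsSmoothField (X - Y) := ContMDiff.sub_section hX hY
  exact sub (sub (hX.nabla hcov (hY.nabla hcov hZ)) (hY.nabla hcov (hX.nabla hcov hZ)))
    ((hX.mlieBracket hY).nabla hcov hZ)

lemma curvature_add₁ (hX : IsSmoothField X) (hX' : IsSmoothField X') (hZ : IsSmoothField Z) :
    curvature cov (X + X') Y Z = curvature cov X Y Z + curvature cov X' Y Z := by
  have hb : VectorField.mlieBracket 𝓘(ℝ, E) (X + X') Y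
      = VectorField.mlieBracket 𝓘(ℝ, E) X Y + VectorField.mlieBracket 𝓘(ℝ, E) X' Y := by
    ext x
    exact VectorField.mlieBracket_add_left (hX.mdifferentiableAt x) (hX'.mdifferentiableAt x)
  rw [curvature_def, curvature_def, curvature_def, hb, nabla_add_left, nabla_add_left,
    nabla_add_left, nabla_add_right (hX.nabla hcov hZ) (hX'.nabla hcov hZ)]
  abel

lemma curvature_smul₁ (hf : ContMDiff 𝓘(ℝ, E) 𝓘(ℝ, ℝ) ∞ f) (hX : IsSmoothField X)
    (hZ : IsSmoothField Z) : curvature cov (f • X) Y Z = f • curvature cov X Y Z := by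
  have hb : VectorField.mlieBracket 𝓘(ℝ, E) (f • X) Y
      = f • VectorField.mlieBracket 𝓘(ℝ, E) X Y
        - (fun x ↦ mvfderiv 𝓘(ℝ, E) f x (Y x)) • X := by
    ext x
    rw [VectorField.mlieBracket_smul_left ((hf x).mdifferentiableAt (by simp))
      (hX.mdifferentiableAt x)]
    simp only [Pi.sub_apply, Pi.smul_apply', neg_smul]
    abel
  have hn : nabla cov (f • VectorField.mlieBracket 𝓘(ℝ, E) X Y
        - (fun x ↦ mvfderiv 𝓘(ℝ, E) f x (Y x)) • X) Z
      = f • nabla cov (VectorField.mlieBracket 𝓘(ℝ, E) X Y) Z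
        - (fun x ↦ mvfderiv 𝓘(ℝ, E) f x (Y x)) • nabla cov X Z := by
    ext x
    simp [nabla]
  rw [curvature_def, curvature_def, hb, hn, nabla_smul_left, nabla_smul_left,
    nabla_smul_right hf (hX.nabla hcov hZ), smul_sub, smul_sub]
  abel

lemma curvature_add₂ (hY : IsSmoothField Y) (hY' : IsSmoothField Y') (hZ : IsSmoothField Z) :
    curvature cov X (Y + Y') Z = curvature cov X Y Z + curvature cov X Y' Z := by
  rw [curvature_swap, curvature_add₁ hcov hY hY' hZ, curvature_swap (X := X),
    curvature_swap (X := X)]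
  abel

lemma curvature_smul₂ (hf : ContMDiff 𝓘(ℝ, E) 𝓘(ℝ, ℝ) ∞ f) (hY : IsSmoothField Y)
    (hZ : IsSmoothField Z) : curvature cov X (f • Y) Z = f • curvature cov X Y Z := by
  rw [curvature_swap, curvature_smul₁ hcov hf hY hZ, curvature_swap (X := X), smul_neg]

omit [CompleteSpace E] in
lemma curvature_add₃ (hX : IsSmoothField X) (hY : IsSmoothField Y) (hZ : IsSmoothField Z)
    (hZ' : IsSmoothField Z') :
    curvature cov X Y (Z + Z') = curvature cov X Y Z + curvature cov X Y Z' := by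
  rw [curvature_def, curvature_def, curvature_def, nabla_add_right hZ hZ', nabla_add_right hZ hZ',
    nabla_add_right hZ hZ', nabla_add_right (hX.nabla hcov hZ) (hX.nabla hcov hZ'),
    nabla_add_right (hY.nabla hcov hZ) (hY.nabla hcov hZ')]
  abel

end

lemma mlieBracket_smul_field (hf : ContMDiff 𝓘(ℝ, E) 𝓘(ℝ, ℝ) ∞ f) (hZ : IsSmoothField Z) :
    VectorField.mlieBracket 𝓘(ℝ, E) X (f • Z)
      = (fun x ↦ mvfderiv 𝓘(ℝ, E) f x (X x)) • Z + f • VectorField.mlieBracket 𝓘(ℝ, E) X Z := by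
  ext x
  exact VectorField.mlieBracket_smul_right ((hf x).mdifferentiableAt (by simp))
    (hZ.mdifferentiableAt x)

lemma mlieBracket_add_field (hY : IsSmoothField Y) (hZ : IsSmoothField Z) :
    VectorField.mlieBracket 𝓘(ℝ, E) X (Y + Z)
      = VectorField.mlieBracket 𝓘(ℝ, E) X Y + VectorField.mlieBracket 𝓘(ℝ, E) X Z := by
  ext x
  exact VectorField.mlieBracket_add_right (hY.mdifferentiableAt x) (hZ.mdifferentiableAt x)

lemma leibniz_mlieBracket (hX : IsSmoothField X) (hY : IsSmoothField Y) (hZ : IsSmoothField Z) :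
    VectorField.mlieBracket 𝓘(ℝ, E) X (VectorField.mlieBracket 𝓘(ℝ, E) Y Z)
      = VectorField.mlieBracket 𝓘(ℝ, E) (VectorField.mlieBracket 𝓘(ℝ, E) X Y) Z
        + VectorField.mlieBracket 𝓘(ℝ, E) Y (VectorField.mlieBracket 𝓘(ℝ, E) X Z) := by
  have h : minSmoothness ℝ 2 ≤ ∞ := by simpa using (ENat.LEInfty.out : (2 : ℕ∞ω) ≤ ∞)
  exact VectorField.leibniz_identity_mlieBracket (ContMDiff.of_le hX h) (ContMDiff.of_le hY h)
    (ContMDiff.of_le hZ h)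

/-- The Lie bracket of vector fields is the commutator of derivations. -/
lemma mvfderiv_mlieBracket_smul (hX : IsSmoothField X) (hY : IsSmoothField Y)
    (hZ : IsSmoothField Z) (hf : ContMDiff 𝓘(ℝ, E) 𝓘(ℝ, ℝ) ∞ f) :
    (fun x ↦ mvfderiv 𝓘(ℝ, E) f x (VectorField.mlieBracket 𝓘(ℝ, E) X Y x)) • Z
      = (fun x ↦ mvfderiv 𝓘(ℝ, E) (fun y ↦ mvfderiv 𝓘(ℝ, E) f y (Y y)) x (X x)) • Z
        - (fun x ↦ mvfderiv 𝓘(ℝ, E) (fun y ↦ mvfderiv 𝓘(ℝ, E) f y (X y)) x (Y x)) • Z := by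
  -- Expand the Jacobi identity for X, Y, fZ and subtract f times the one for X, Y, Z: mixed terms
  -- cancel and only second derivatives of f times Z survive.
  have h := leibniz_mlieBracket hX hY (hZ.smul hf)
  have hXf := hX.mvfderiv_apply hf
  have hYf := hY.mvfderiv_apply hf
  rw [mlieBracket_smul_field hf hZ, mlieBracket_smul_field hf hZ, mlieBracket_smul_field hf hZ,
    mlieBracket_add_field (hZ.smul hYf) ((hY.mlieBracket hZ).smul hf),
    mlieBracket_add_field (hZ.smul hXf) ((hX.mlieBracket hZ).smul hf),
    mlieBracket_smul_field hYf hZ, mlieBracket_smul_field hXf hZ,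
    mlieBracket_smul_field hf (hY.mlieBracket hZ), mlieBracket_smul_field hf (hX.mlieBracket hZ),
    leibniz_mlieBracket hX hY hZ, smul_add] at h
  rw [← sub_eq_zero] at h ⊢
  rw [← neg_eq_zero, ← h]
  abel

section

variable (hcov : CovariantDerivative.ContMDiffCovariantDerivative cov ∞)

include hcov

lemma curvature_smul₃ (hf : ContMDiff 𝓘(ℝ, E) 𝓘(ℝ, ℝ) ∞ f) (hX : IsSmoothField X)
    (hY : IsSmoothField Y) (hZ : IsSmoothField Z) :
    curvature cov X Y (f • Z) = f • curvature cov X Y Z := by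
  have hXf := hX.mvfderiv_apply hf
  have hYf := hY.mvfderiv_apply hf
  have hXZ := hX.nabla hcov hZ
  have hYZ := hY.nabla hcov hZ
  rw [curvature_def, curvature_def, nabla_smul_right hf hZ, nabla_smul_right hf hZ,
    nabla_smul_right hf hZ, nabla_add_right (hYZ.smul hf) (hZ.smul hYf),
    nabla_add_right (hXZ.smul hf) (hZ.smul hXf), nabla_smul_right hf hYZ,
    nabla_smul_right hf hXZ, nabla_smul_right hXf hZ, nabla_smul_right hYf hZ,
    mvfderiv_mlieBracket_smul hX hY hZ hf, smul_sub, smul_sub]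
  abel

end

/-- The vector field `(∇_W R)(X, Y) Z`. -/
noncomputable def nablaCurvature (cov : Connection E M)
    (W X Y Z : Π x : M, TangentSpace 𝓘(ℝ, E) x) : Π x : M, TangentSpace 𝓘(ℝ, E) x :=
  nabla cov W (curvature cov X Y Z) - curvature cov (nabla cov W X) Y Z
    - curvature cov X (nabla cov W Y) Z - curvature cov X Y (nabla cov W Z)

/-- The tensor `∇R` vanishes as soon as it vanishes on the members of a global frame. -/
theorem hasParallelCurvature_of_frame
    (hcov : CovariantDerivative.ContMDiffCovariantDerivative cov ∞)
    {ι : Type*} [Fintype ι] {e : ι → Π x : M, TangentSpace 𝓘(ℝ, E) x}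
    (he : ∀ i, IsSmoothField (e i))
    (hframe : ∀ X, IsSmoothField X → ∃ c : ι → M → ℝ,
      (∀ i, ContMDiff 𝓘(ℝ, E) 𝓘(ℝ, ℝ) ∞ (c i)) ∧ X = ∑ i, c i • e i)
    (h : ∀ i j k l, nablaCurvature cov (e i) (e j) (e k) (e l) = 0) :
    HasParallelCurvature cov := by
  suffices H : ∀ W X Y Z, IsSmoothField W → IsSmoothField X → IsSmoothField Y →
      IsSmoothField Z → ∀ x, nablaCurvature cov W X Y Z x = 0 from H
  have step {Φ : (Π x : M, TangentSpace 𝓘(ℝ, E) x) → (Π x : M, TangentSpace 𝓘(ℝ, E) x)}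
      (hadd : ∀ X Y, IsSmoothField X → IsSmoothField Y → Φ (X + Y) = Φ X + Φ Y)
      (hsmul : ∀ (f : M → ℝ) X, ContMDiff 𝓘(ℝ, E) 𝓘(ℝ, ℝ) ∞ f → IsSmoothField X →
        Φ (f • X) = f • Φ X)
      (hzero : ∀ i, Φ (e i) = 0) (X) (hX : IsSmoothField X) : Φ X = 0 := by
    obtain ⟨c, hc, hXc⟩ := hframe X hX
    ext x
    exact eq_zero_of_frame he (x := x) (fun X ↦ Φ X x)
      (fun X Y hX hY ↦ congrFun (hadd X Y hX hY) x)
      (fun f X hf hX ↦ congrFun (hsmul f X hf hX) x) (fun i ↦ congrFun (hzero i) x) hc hXc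
  -- Arguments are freed from the frame one at a time, starting with the last.
  have h₄ : ∀ i j k Z, IsSmoothField Z → nablaCurvature cov (e i) (e j) (e k) Z = 0 := by
    intro i j k
    have hi := he i
    have hj := he j
    have hk := he k
    refine step (fun X Y hX hY ↦ ?_) (fun f X hf hX ↦ ?_) (h i j k)
    · simp only [nablaCurvature]
      rw [curvature_add₃ hcov hj hk hX hY,
        curvature_add₃ hcov (hi.nabla hcov hj) hk hX hY,
        curvature_add₃ hcov hj (hi.nabla hcov hk) hX hY, nabla_add_right hX hY,
        curvature_add₃ hcov hj hk (hi.nabla hcov hX) (hi.nabla hcov hY),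
        nabla_add_right (isSmoothField_curvature hcov hj hk hX)
          (isSmoothField_curvature hcov hj hk hY)]
      abel
    · have hd := hi.mvfderiv_apply hf
      simp only [nablaCurvature]
      rw [curvature_smul₃ hcov hf hj hk hX,
        curvature_smul₃ hcov hf (hi.nabla hcov hj) hk hX,
        curvature_smul₃ hcov hf hj (hi.nabla hcov hk) hX, nabla_smul_right hf hX,
        curvature_add₃ hcov hj hk ((hi.nabla hcov hX).smul hf) (hX.smul hd),
        curvature_smul₃ hcov hf hj hk (hi.nabla hcov hX),
        curvature_smul₃ hcov hd hj hk hX,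
        nabla_smul_right hf (isSmoothField_curvature hcov hj hk hX), smul_sub, smul_sub, smul_sub]
      abel
  have h₃ : ∀ i j Z, IsSmoothField Z → ∀ Y, IsSmoothField Y →
      nablaCurvature cov (e i) (e j) Y Z = 0 := by
    intro i j Z hZ
    have hi := he i
    have hj := he j
    have hiZ := hi.nabla hcov hZ
    refine step (fun X Y hX hY ↦ ?_) (fun f X hf hX ↦ ?_) (fun k ↦ h₄ i j k Z hZ)
    · simp only [nablaCurvature]
      rw [curvature_add₂ hcov hX hY hZ, curvature_add₂ hcov hX hY hZ, nabla_add_right hX hY,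
        curvature_add₂ hcov (hi.nabla hcov hX) (hi.nabla hcov hY) hZ,
        curvature_add₂ hcov hX hY hiZ,
        nabla_add_right (isSmoothField_curvature hcov hj hX hZ)
          (isSmoothField_curvature hcov hj hY hZ)]
      abel
    · have hd := hi.mvfderiv_apply hf
      simp only [nablaCurvature]
      rw [curvature_smul₂ hcov hf hX hZ, curvature_smul₂ hcov hf hX hZ, nabla_smul_right hf hX,
        curvature_add₂ hcov ((hi.nabla hcov hX).smul hf) (hX.smul hd) hZ,
        curvature_smul₂ hcov hf (hi.nabla hcov hX) hZ, curvature_smul₂ hcov hd hX hZ,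
        curvature_smul₂ hcov hf hX hiZ,
        nabla_smul_right hf (isSmoothField_curvature hcov hj hX hZ), smul_sub, smul_sub, smul_sub]
      abel
  have h₂ : ∀ i Y Z, IsSmoothField Y → IsSmoothField Z → ∀ X, IsSmoothField X →
      nablaCurvature cov (e i) X Y Z = 0 := by
    intro i Y' Z hY' hZ
    have hi := he i
    have hiZ := hi.nabla hcov hZ
    refine step (fun X Y hX hY ↦ ?_) (fun f X hf hX ↦ ?_) (fun j ↦ h₃ i j Z hZ Y' hY')
    · simp only [nablaCurvature]
      rw [curvature_add₁ hcov hX hY hZ, curvature_add₁ hcov hX hY hZ, nabla_add_right hX hY,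
        curvature_add₁ hcov (hi.nabla hcov hX) (hi.nabla hcov hY) hZ,
        curvature_add₁ hcov hX hY hiZ,
        nabla_add_right (isSmoothField_curvature hcov hX hY' hZ)
          (isSmoothField_curvature hcov hY hY' hZ)]
      abel
    · have hd := hi.mvfderiv_apply hf
      simp only [nablaCurvature]
      rw [curvature_smul₁ hcov hf hX hZ, curvature_smul₁ hcov hf hX hZ, nabla_smul_right hf hX,
        curvature_add₁ hcov ((hi.nabla hcov hX).smul hf) (hX.smul hd) hZ,
        curvature_smul₁ hcov hf (hi.nabla hcov hX) hZ, curvature_smul₁ hcov hd hX hZ,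
        curvature_smul₁ hcov hf hX hiZ,
        nabla_smul_right hf (isSmoothField_curvature hcov hX hY' hZ), smul_sub, smul_sub, smul_sub]
      abel
  intro W X Y Z hW hX hY hZ x
  refine congrFun (step (Φ := fun W ↦ nablaCurvature cov W X Y Z) (fun W W' hW hW' ↦ ?_)
    (fun f W hf hW ↦ ?_) (fun i ↦ h₂ i Y Z hY hZ X hX) W hW) x
  · simp only [nablaCurvature, nabla_add_left]
    rw [curvature_add₁ hcov (hW.nabla hcov hX) (hW'.nabla hcov hX) hZ,
      curvature_add₂ hcov (hW.nabla hcov hY) (hW'.nabla hcov hY) hZ,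
      curvature_add₃ hcov hX hY (hW.nabla hcov hZ) (hW'.nabla hcov hZ)]
    abel
  · simp only [nablaCurvature, nabla_smul_left]
    rw [curvature_smul₁ hcov hf (hW.nabla hcov hX) hZ,
      curvature_smul₂ hcov hf (hW.nabla hcov hY) hZ,
      curvature_smul₃ hcov hf hX hY (hW.nabla hcov hZ), smul_sub, smul_sub, smul_sub]

end Tensoriality

/-! ### Left-invariant vector fields -/

section Invariant

variable {E : Type*} [NormedAddCommGroup E] [NormedSpace ℝ E]
  {G : Type*} [TopologicalSpace G] [ChartedSpace E G] [Group G]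

-- The fibres over x and y are different types, so the equality is stated on the model space `E`;
-- likewise below for points such as `x * 1` and `x`.
omit [Group G] in
lemma mfderiv_congr_base (f : G → G) {x y : G} (h : x = y) :
    (mfderiv 𝓘(ℝ, E) 𝓘(ℝ, E) f x : E →L[ℝ] E) = (mfderiv 𝓘(ℝ, E) 𝓘(ℝ, E) f y : E →L[ℝ] E) := by
  rw [h]

omit [Group G] in
lemma mfderiv_congr_fun {f f' : G → G} (h : f = f') (x : G) :
    (mfderiv 𝓘(ℝ, E) 𝓘(ℝ, E) f x : E →L[ℝ] E) = (mfderiv 𝓘(ℝ, E) 𝓘(ℝ, E) f' x : E →L[ℝ] E) := by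
  rw [h]

lemma mulInvariantVectorField_one (v : GroupLieAlgebra 𝓘(ℝ, E) G) :
    mulInvariantVectorField v (1 : G) = v := by
  have : (fun x : G ↦ 1 * x) = id := by
    ext x
    simp
  have h : (mfderiv 𝓘(ℝ, E) 𝓘(ℝ, E) (fun x : G ↦ 1 * x) 1 : E →L[ℝ] E)
      = (mfderiv 𝓘(ℝ, E) 𝓘(ℝ, E) (id : G → G) 1 : E →L[ℝ] E) :=
    mfderiv_congr_fun this 1
  rw [mfderiv_id] at h
  exact congrArg (fun L : E →L[ℝ] E ↦ L v) h

lemma mulInvariantVectorField_smul_field (c : ℝ) (v : GroupLieAlgebra 𝓘(ℝ, E) G) :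
    (fun x : G ↦ mulInvariantVectorField (c • v) x)
      = (fun _ : G ↦ c) • fun x : G ↦ mulInvariantVectorField v x := by
  ext x
  exact map_smul (mfderiv 𝓘(ℝ, E) 𝓘(ℝ, E) (fun y : G ↦ x * y) 1 : E →L[ℝ] E) c v

lemma mulInvariantVectorField_add_field (v w : GroupLieAlgebra 𝓘(ℝ, E) G) :
    (fun x : G ↦ mulInvariantVectorField (v + w) x)
      = (fun x : G ↦ mulInvariantVectorField v x) + fun x : G ↦ mulInvariantVectorField w x := by
  ext x
  exact map_add (mfderiv 𝓘(ℝ, E) 𝓘(ℝ, E) (fun y : G ↦ x * y) 1 : E →L[ℝ] E) v w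

/-- The linear map sending a vector in the Lie algebra to its invariant field at `x`. -/
noncomputable def invariantAt (x : G) :
    GroupLieAlgebra 𝓘(ℝ, E) G →ₗ[ℝ] TangentSpace 𝓘(ℝ, E) x where
  toFun v := mulInvariantVectorField v x
  map_add' v w := congrFun (mulInvariantVectorField_add_field v w) x
  map_smul' c v := congrFun (mulInvariantVectorField_smul_field c v) x

/-- The left-invariant vector field with value `v` at the identity. -/
noncomputable def inv (v : GroupLieAlgebra 𝓘(ℝ, E) G) : Π x : G, TangentSpace 𝓘(ℝ, E) x :=
  fun x ↦ invariantAt x v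

lemma inv_one (v : GroupLieAlgebra 𝓘(ℝ, E) G) : inv v (1 : G) = v := mulInvariantVectorField_one v

lemma inv_add (v w : GroupLieAlgebra 𝓘(ℝ, E) G) : inv (v + w) = inv v + inv w :=
  mulInvariantVectorField_add_field v w

lemma inv_smul (c : ℝ) (v : GroupLieAlgebra 𝓘(ℝ, E) G) : inv (c • v) = (fun _ : G ↦ c) • inv v :=
  mulInvariantVectorField_smul_field c v

lemma inv_neg (v : GroupLieAlgebra 𝓘(ℝ, E) G) : inv (-v) = -inv v := by
  ext x
  exact map_neg (invariantAt x) v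

lemma inv_sub (v w : GroupLieAlgebra 𝓘(ℝ, E) G) : inv (v - w) = inv v - inv w := by
  ext x
  exact map_sub (invariantAt x) v w

lemma inv_zero : inv (0 : GroupLieAlgebra 𝓘(ℝ, E) G) = 0 := by
  ext x
  exact map_zero (invariantAt x)

variable [LieGroup 𝓘(ℝ, E) ∞ G]

lemma mfderiv_mul_left_comp (a b c : G) (v : TangentSpace 𝓘(ℝ, E) c) :
    mfderiv 𝓘(ℝ, E) 𝓘(ℝ, E) (fun x : G ↦ a * x) (b * c)
        (mfderiv 𝓘(ℝ, E) 𝓘(ℝ, E) (fun x : G ↦ b * x) c v)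
      = mfderiv 𝓘(ℝ, E) 𝓘(ℝ, E) (fun x : G ↦ a * b * x) c v := by
  have hs (a b : G) : MDifferentiableAt 𝓘(ℝ, E) 𝓘(ℝ, E) (fun x : G ↦ a * x) b :=
    (contMDiff_mul_left (I := 𝓘(ℝ, E)) (n := ∞) (a := a) b).mdifferentiableAt (by simp)
  have h := mfderiv_comp c (hs a (b * c)) (hs b c)
  have e : (fun x : G ↦ a * x) ∘ (fun x : G ↦ b * x) = fun x ↦ a * b * x := by
    ext x
    simp [mul_assoc]
  rw [e] at h
  rw [h]
  rfl

lemma exists_mulInvariantVectorField_eq (x : G) (u : TangentSpace 𝓘(ℝ, E) x) :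
    ∃ v : GroupLieAlgebra 𝓘(ℝ, E) G, mulInvariantVectorField v x = u := by
  let w : E := mfderiv 𝓘(ℝ, E) 𝓘(ℝ, E) (fun y : G ↦ x⁻¹ * y) x u
  refine ⟨w, ?_⟩
  have h := mfderiv_mul_left_comp x x⁻¹ x u
  have h' := mfderiv_congr_base (E := E) (fun y : G ↦ x * y) (inv_mul_cancel x)
  have e : (fun y : G ↦ x * x⁻¹ * y) = id := by
    ext y
    simp
  have h'' : (mfderiv 𝓘(ℝ, E) 𝓘(ℝ, E) (fun y : G ↦ x * x⁻¹ * y) x : E →L[ℝ] E)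
      = (mfderiv 𝓘(ℝ, E) 𝓘(ℝ, E) (id : G → G) x : E →L[ℝ] E) :=
    mfderiv_congr_fun e x
  rw [mfderiv_id] at h''
  exact ((congrArg (fun L : E →L[ℝ] E ↦ L w) h').symm.trans h).trans
    (congrArg (fun L : E →L[ℝ] E ↦ L u) h'')

/-- The field is the tangent map of multiplication applied to the smooth map g ↦ (0 at g, v at 1).
-/
theorem isSmoothField_mulInvariantVectorField (v : GroupLieAlgebra 𝓘(ℝ, E) G) :
    IsSmoothField (fun x : G ↦ mulInvariantVectorField v x) := by
  let I := 𝓘(ℝ, E)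
  let fg : G → TangentBundle I G := fun g ↦ TotalSpace.mk' E g 0
  have sfg : ContMDiff I I.tangent ∞ fg := contMDiff_zeroSection _ _
  let fv : G → TangentBundle I G := fun _ ↦ TotalSpace.mk' E 1 v
  have sfv : ContMDiff I I.tangent ∞ fv := contMDiff_const
  let F₁ : G → (TangentBundle I G × TangentBundle I G) := fun g ↦ (fg g, fv g)
  have S₁ : ContMDiff I (I.tangent.prod I.tangent) ∞ F₁ := sfg.prodMk sfv
  let F₂ : (TangentBundle I G × TangentBundle I G) → TangentBundle (I.prod I) (G × G) :=
    (equivTangentBundleProd I G I G).symm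
  have S₂ : ContMDiff (I.tangent.prod I.tangent) (I.prod I).tangent ∞ F₂ :=
    contMDiff_equivTangentBundleProd_symm
  let F₃ : TangentBundle (I.prod I) (G × G) → TangentBundle I G :=
    tangentMap (I.prod I) I (fun (p : G × G) ↦ p.1 * p.2)
  have S₃ : ContMDiff (I.prod I).tangent I.tangent ∞ F₃ := by
    refine ContMDiff.contMDiff_tangentMap (n := ∞) (contMDiff_mul I ∞) (by simp)
  let S := (S₃.comp S₂).comp S₁
  unfold IsSmoothField
  convert! S with g
  · simp [F₁, F₂, F₃, fg, fv]
  · simp only [Function.comp_apply, tangentMap, F₃, F₂, F₁, fg, fv]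
    rw [mfderiv_prod_eq_add_apply ((contMDiff_mul I ∞).mdifferentiableAt (by simp))]
    change _ = (mfderiv I I (fun z : G ↦ z * 1) g : E →L[ℝ] E) 0
      + (mfderiv I I (fun z : G ↦ g * z) 1 : E →L[ℝ] E) v
    rw [map_zero, zero_add]
    rfl

lemma isSmoothField_inv (v : GroupLieAlgebra 𝓘(ℝ, E) G) : IsSmoothField (inv v) :=
  isSmoothField_mulInvariantVectorField v

lemma exists_inv_eq (x : G) (u : TangentSpace 𝓘(ℝ, E) x) :
    ∃ v : GroupLieAlgebra 𝓘(ℝ, E) G, inv v x = u :=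
  exists_mulInvariantVectorField_eq x u

lemma mlieBracket_inv [CompleteSpace E] (v w : GroupLieAlgebra 𝓘(ℝ, E) G) :
    VectorField.mlieBracket 𝓘(ℝ, E) (inv v) (inv w) = inv ⁅v, w⁆ :=
  (mulInvariantVector_mlieBracket v w).symm

lemma inner_inv {g : RiemMetric E G} (hg : IsLeftInvariantMetric g) (x : G)
    (v w : GroupLieAlgebra 𝓘(ℝ, E) G) : g.inner x (inv v x) (inv w x) = g.inner 1 v w := by
  have h := hg x 1 v w
  have key : ∀ y : G, y = x → (g.inner y : E →L[ℝ] E →L[ℝ] ℝ)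
      = (g.inner x : E →L[ℝ] E →L[ℝ] ℝ) := by
    rintro _ rfl
    rfl
  have key' := congrArg (fun L : E →L[ℝ] E →L[ℝ] ℝ ↦ L (inv v x) (inv w x)) (key _ (mul_one x))
  exact key'.symm.trans h

omit [LieGroup 𝓘(ℝ, E) ∞ G] in
lemma apply_inv {J : Π x : G, TangentSpace 𝓘(ℝ, E) x →L[ℝ] TangentSpace 𝓘(ℝ, E) x}
    (hJ : IsLeftInvariantJ J) (v : GroupLieAlgebra 𝓘(ℝ, E) G) :
    (fun x ↦ J x (inv v x)) = inv (J 1 v) := by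
  ext x
  have h := hJ x 1 v
  have key : ∀ y : G, y = x → (J y : E →L[ℝ] E) = (J x : E →L[ℝ] E) := by
    rintro _ rfl
    rfl
  have key' := congrArg (fun L : E →L[ℝ] E ↦ L (inv v x)) (key _ (mul_one x))
  exact key'.symm.trans h.symm

end Invariant

/-! ### Invariance of the Bismut connection and conclusion -/

section Bismut

/-- The coefficients `a` of a Hermitian connection with totally skew-symmetric torsion `t` are
determined by the structure constants `c`. -/
lemma two_mul_connection_coeff {V : Type*} (J : V → V) (a c t : V → V → V → ℝ)
    (hc : ∀ u v w, c u v w = a u v w - a v u w - t u v w)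
    (ha : ∀ u v w, a u v w = -a u w v)
    (haJ : ∀ u v w, a u (J v) w = -a u v (J w))
    (haJJ : ∀ u v w, a u (J v) (J w) = a u v w)
    (ht₁₂ : ∀ u v w, t u v w = -t v u w) (ht₂₃ : ∀ u v w, t u v w = -t u w v)
    (hN : ∀ u v w, c (J u) (J v) w + c (J u) v (J w) + c u (J v) (J w) - c u v w = 0)
    (u v w : V) :
    2 * a u v w = c u v w - c v w u + c w u v
      - (c (J u) (J v) w + c (J v) (J w) u + c (J w) (J u) v) := by
  -- The Koszul combination of the `c` equals 2a - t, and the vanishing Nijenhuis tensor identifies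
  -- the cyclic sum of c(J·, J·, ·) with -t.
  have n := hN u v w
  simp only [hc] at n ⊢
  have b1 := haJJ u v w
  have b2 := haJJ v u w
  have b3 := haJ (J u) v w
  have b4 := haJ (J v) u w
  have b5 := haJ (J u) w v
  have b6 := haJ (J v) w u
  have b7 := haJ (J w) u v
  have b8 := haJ (J w) v u
  have s1 := ha u v w
  have s2 := ha v u w
  have s3 := ha w u v
  have s4 := ha (J u) v (J w)
  have s5 := ha (J v) u (J w)
  have s6 := ha (J w) u (J v)
  have s7 := ha (J u) (J v) w
  have s8 := ha (J v) (J u) w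
  have s9 := ha (J w) (J u) v
  have t1 := ht₂₃ u v w
  have t2 := ht₁₂ u w v
  have t3 := ht₁₂ u v w
  have t4 := ht₂₃ v u w
  have t5 := ht₂₃ (J u) v (J w)
  have t6 := ht₁₂ (J u) (J w) v
  have t7 := ht₁₂ u (J v) (J w)
  have t8 := ht₂₃ (J v) u (J w)
  have t9 := ht₂₃ w u v
  have t10 := ht₁₂ w v u
  linarith

variable {E : Type*} [NormedAddCommGroup E] [NormedSpace ℝ E] [FiniteDimensional ℝ E]
  [CompleteSpace E]

section General

variable {M : Type*} [TopologicalSpace M] [ChartedSpace E M] [IsManifold 𝓘(ℝ, E) ∞ M]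

lemma torsionField_eq {cov : Connection E M} {X Y : Π x : M, TangentSpace 𝓘(ℝ, E) x}
    (hX : IsSmoothField X) (hY : IsSmoothField Y) :
    torsionField cov X Y
      = nabla cov X Y - nabla cov Y X - VectorField.mlieBracket 𝓘(ℝ, E) X Y := by
  ext x
  exact cov.torsion_apply (hX.mdifferentiableAt x) (hY.mdifferentiableAt x)

end General

variable {G : Type*} [TopologicalSpace G] [ChartedSpace E G] [Group G] [LieGroup 𝓘(ℝ, E) ∞ G]

/-- The bilinear map on the Lie algebra given by `∇_{X_u} X_v` at the identity. -/
noncomputable def connectionAtOne (cov : Connection E G) :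
    GroupLieAlgebra 𝓘(ℝ, E) G →ₗ[ℝ] GroupLieAlgebra 𝓘(ℝ, E) G →ₗ[ℝ] GroupLieAlgebra 𝓘(ℝ, E) G :=
  LinearMap.mk₂ ℝ (fun u v ↦ cov (inv v) 1 u)
    (fun u u' v ↦ map_add _ _ _) (fun c u v ↦ map_smul _ _ _)
    (fun u v v' ↦ by
      have h := congrFun (nabla_add_right (cov := cov) (X := inv u) (isSmoothField_inv v)
        (isSmoothField_inv v')) 1
      simp only [nabla, ← inv_add, inv_one, Pi.add_apply] at h
      exact h)
    (fun c u v ↦ by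
      have h := congrFun (nabla_smul_right (cov := cov) (X := inv u) (f := fun _ ↦ c)
        contMDiff_const (isSmoothField_inv v)) 1
      simp only [nabla, ← inv_smul, inv_one, Pi.add_apply, Pi.smul_apply', mvfderiv_const,
        zero_apply, zero_smul, add_zero] at h
      exact h)

omit [FiniteDimensional ℝ E] [CompleteSpace E] in
lemma connectionAtOne_apply (cov : Connection E G) (u v : GroupLieAlgebra 𝓘(ℝ, E) G) :
    connectionAtOne cov u v = nabla cov (inv u) (inv v) 1 := by
  simp only [nabla, inv_one]
  rfl

variable {J : Π x : G, TangentSpace 𝓘(ℝ, E) x →L[ℝ] TangentSpace 𝓘(ℝ, E) x}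
  {g : RiemMetric E G} {cov : Connection E G}

lemma inner_nabla_inv_skew (hginv : IsLeftInvariantMetric g) (hcov : IsBismut J g cov) (x : G)
    (u v w : GroupLieAlgebra 𝓘(ℝ, E) G) :
    g.inner x (nabla cov (inv u) (inv v) x) (inv w x)
      = -g.inner x (nabla cov (inv u) (inv w) x) (inv v x) := by
  have h := hcov.metric _ _ _ (isSmoothField_inv u) (isSmoothField_inv v) (isSmoothField_inv w) x
  have e : (fun y : G ↦ g.inner y (inv v y) (inv w y)) = fun _ ↦ g.inner 1 v w := by
    ext y
    exact inner_inv hginv y v w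
  rw [e, mvfderiv_const, zero_apply, g.symm x (inv v x)] at h
  linarith

/-- The Bismut connection of left-invariant data is left-invariant. -/
theorem nabla_inv (hJ : IsComplexStructure J) (hJinv : IsLeftInvariantJ J)
    (hginv : IsLeftInvariantMetric g) (hgJ : IsCompatible J g) (hcov : IsBismut J g cov)
    (u v : GroupLieAlgebra 𝓘(ℝ, E) G) :
    nabla cov (inv u) (inv v) = inv (connectionAtOne cov u v) := by
  have hcompl (u v : GroupLieAlgebra 𝓘(ℝ, E) G) (x : G) :
      nabla cov (inv u) (inv (J 1 v)) x = J x (nabla cov (inv u) (inv v) x) := by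
    have h := hcov.complex _ _ (isSmoothField_inv u) (isSmoothField_inv v) x
    rwa [apply_inv hJinv] at h
  have hJx (x : G) (v : GroupLieAlgebra 𝓘(ℝ, E) G) : J x (inv v x) = inv (J 1 v) x :=
    congrFun (apply_inv hJinv v) x
  have hgJ' (x : G) (p q : TangentSpace 𝓘(ℝ, E) x) :
      g.inner x (J x p) q = -g.inner x p (J x q) := by
    have h := hgJ x p (J x q)
    rw [hJ.sq, map_neg] at h
    linarith
  have hN (u v w : GroupLieAlgebra 𝓘(ℝ, E) G) :
      g.inner 1 ⁅J 1 u, J 1 v⁆ w + g.inner 1 ⁅J 1 u, v⁆ (J 1 w) + g.inner 1 ⁅u, J 1 v⁆ (J 1 w)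
        - g.inner 1 ⁅u, v⁆ w = 0 := by
    have h := hJ.nijenhuis _ _ (isSmoothField_inv u) (isSmoothField_inv v) 1
    rw [apply_inv hJinv, apply_inv hJinv, mlieBracket_inv, mlieBracket_inv, mlieBracket_inv,
      mlieBracket_inv] at h
    simp only [inv_one] at h
    have h' := congrArg (fun p ↦ g.inner 1 p w) h
    simp only [map_sub, sub_apply, hgJ', map_zero,
      zero_apply] at h'
    linarith
  -- The right side of this formula involves only brackets at the identity, so the coefficients of
  -- the connection in invariant fields do not depend on x.
  have coeff (x : G) (u v w : GroupLieAlgebra 𝓘(ℝ, E) G) :=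
    two_mul_connection_coeff (fun v ↦ J 1 v)
      (fun u v w ↦ g.inner x (nabla cov (inv u) (inv v) x) (inv w x))
      (fun u v w ↦ g.inner 1 ⁅u, v⁆ w)
      (fun u v w ↦ g.inner x (cov.torsion x (inv u x) (inv v x)) (inv w x))
      (fun u v w ↦ by
        have ht : cov.torsion x (inv u x) (inv v x) = _ :=
          congrFun (torsionField_eq (cov := cov) (isSmoothField_inv u) (isSmoothField_inv v)) x
        rw [ht, mlieBracket_inv]
        simp only [Pi.sub_apply, map_sub, sub_apply, inner_inv hginv]
        ring)
      (fun u v w ↦ inner_nabla_inv_skew hginv hcov x u v w)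
      (fun u v w ↦ by rw [hcompl, hgJ', hJx])
      (fun u v w ↦ by rw [hcompl, ← hJx, hgJ])
      (fun u v w ↦ hcov.skew₁₂ x _ _ _) (fun u v w ↦ hcov.skew₂₃ x _ _ _) hN u v w
  ext x
  obtain ⟨k, hk⟩ := exists_inv_eq x (nabla cov (inv u) (inv v) x)
  have hw (w : GroupLieAlgebra 𝓘(ℝ, E) G) :
      g.inner 1 k w = g.inner 1 (connectionAtOne cov u v) w := by
    have h1 := coeff x u v w
    have h2 := coeff 1 u v w
    simp only [← hk, inner_inv hginv] at h1
    simp only [← connectionAtOne_apply, inv_one] at h2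
    linarith
  have hkA : k = connectionAtOne cov u v := by
    by_contra hne
    have hpos := g.pos 1 (k - connectionAtOne cov u v) (sub_ne_zero.2 hne)
    rw [ContinuousLinearMap.map_sub₂, hw, sub_self] at hpos
    exact lt_irrefl _ hpos
  rw [← hk, hkA]

omit [CompleteSpace E] in
/-- Every smooth field on a Lie group is a combination with smooth coefficients of a fixed finite
family of left-invariant fields. -/
theorem exists_invariant_frame (hginv : IsLeftInvariantMetric g) :
    ∃ (n : ℕ) (e : Fin n → GroupLieAlgebra 𝓘(ℝ, E) G), ∀ X : Π x : G, TangentSpace 𝓘(ℝ, E) x,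
      IsSmoothField X → ∃ c : Fin n → G → ℝ,
        (∀ i, ContMDiff 𝓘(ℝ, E) 𝓘(ℝ, ℝ) ∞ (c i)) ∧ X = ∑ i, c i • inv (e i) := by
  have : FiniteDimensional ℝ (GroupLieAlgebra 𝓘(ℝ, E) G) := ‹FiniteDimensional ℝ E›
  let B : LinearMap.BilinForm ℝ (GroupLieAlgebra 𝓘(ℝ, E) G) :=
    LinearMap.mk₂ ℝ (fun u v ↦ g.inner 1 u v) (by simp) (by simp) (by simp) (by simp)
  obtain ⟨b, hb⟩ := LinearMap.BilinForm.exists_orthogonal_basis (B := B) ⟨fun u v ↦ g.symm 1 u v⟩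
  -- Invariant fields extending a g-orthogonal basis at 1 stay orthogonal with constant norms, so
  -- the coefficients are inner products divided by constants.
  refine ⟨_, b, fun X hX ↦ ⟨fun i x ↦ g.inner x (X x) (inv (b i) x) / g.inner 1 (b i) (b i),
    fun i ↦ ?_, ?_⟩⟩
  · exact (hX.inner (isSmoothField_inv (b i))).div_const _
  · ext x
    obtain ⟨k, hk⟩ := exists_inv_eq x (X x)
    have hpos (i) : g.inner 1 (b i) (b i) ≠ 0 := (g.pos 1 (b i) (b.ne_zero i)).ne'
    have hrep (i) : g.inner 1 k (b i) = b.repr k i * g.inner 1 (b i) (b i) := by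
      have h : B k (b i) = B (∑ j, b.repr k j • b j) (b i) := by rw [b.sum_repr]
      rw [map_sum, LinearMap.sum_apply, Finset.sum_eq_single i] at h
      · rw [map_smul, LinearMap.smul_apply] at h
        exact h
      · intro j _ hj
        rw [map_smul, LinearMap.smul_apply]
        have : B (b j) (b i) = 0 := hb hj
        rw [this, smul_zero]
      · simp
    have hsum : inv k x = ∑ i, b.repr k i • inv (b i) x := by
      have h := congrArg (invariantAt x) (b.sum_repr k)
      rw [map_sum] at h
      rw [inv, ← h]
      exact Finset.sum_congr rfl fun i _ ↦ map_smul _ _ _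
    rw [Finset.sum_apply, ← hk]
    nth_rw 1 [hsum]
    refine Finset.sum_congr rfl fun i _ ↦ ?_
    simp only [Pi.smul_apply', ← hk, inner_inv hginv, hrep, mul_div_cancel_right₀ _ (hpos i)]

/-- The algebraic data on the Lie algebra of a Lie group with left-invariant Hermitian structure
whose Bismut connection has parallel torsion. -/
noncomputable def parallelSkewTorsion (hJ : IsComplexStructure J) (hJinv : IsLeftInvariantJ J)
    (hginv : IsLeftInvariantMetric g) (hgJ : IsCompatible J g) (hcov : IsBismut J g cov)
    (hpar : HasParallelTorsion cov) : ParallelSkewTorsion (GroupLieAlgebra 𝓘(ℝ, E) G) :=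
  have tor (u v : GroupLieAlgebra 𝓘(ℝ, E) G) : torsionField cov (inv u) (inv v)
      = inv (connectionAtOne cov u v - connectionAtOne cov v u - ⁅u, v⁆) := by
    rw [torsionField_eq (isSmoothField_inv u) (isSmoothField_inv v), mlieBracket_inv, inv_sub,
      inv_sub, nabla_inv hJ hJinv hginv hgJ hcov, nabla_inv hJ hJinv hginv hgJ hcov]
  { br := LinearMap.mk₂ ℝ (fun u v ↦ ⁅u, v⁆) (by simp) (by simp) (by simp) (by simp)
    A := connectionAtOne cov
    J := endAtOne J
    B := LinearMap.mk₂ ℝ (fun u v ↦ g.inner 1 u v) (by simp) (by simp) (by simp) (by simp)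
    T := fun u v ↦ connectionAtOne cov u v - connectionAtOne cov v u - ⁅u, v⁆
    T_def := fun _ _ ↦ rfl
    br_skew := fun x y ↦ (lie_skew x y).symm
    jacobi := fun x y z ↦ leibniz_lie x y z
    B_symm := fun x y ↦ g.symm 1 x y
    B_pos := fun x hx ↦ g.pos 1 x hx
    J_sq := fun x ↦ hJ.sq 1 x
    B_J := fun x y ↦ hgJ 1 x y
    A_skew := fun x y z ↦ by
      have h := inner_nabla_inv_skew hginv hcov 1 x y z
      rwa [← connectionAtOne_apply, ← connectionAtOne_apply, inv_one, inv_one] at h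
    A_J := fun x y ↦ by
      have h := hcov.complex _ _ (isSmoothField_inv x) (isSmoothField_inv y) 1
      rwa [apply_inv hJinv, ← connectionAtOne_apply, ← connectionAtOne_apply] at h
    T_skew := fun x y z ↦ by
      have h := hcov.skew₂₃ 1 x y z
      have e (u v : GroupLieAlgebra 𝓘(ℝ, E) G) : cov.torsion 1 u v
          = connectionAtOne cov u v - connectionAtOne cov v u - ⁅u, v⁆ := by
        have := congrFun (tor u v) 1
        rwa [torsionField, inv_one, inv_one, inv_one] at this
      rwa [e, e] at h
    parallel := fun w x y ↦ by
      have h := hpar _ _ _ (isSmoothField_inv w) (isSmoothField_inv x) (isSmoothField_inv y) 1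
      rw [tor, nabla_inv hJ hJinv hginv hgJ hcov, nabla_inv hJ hJinv hginv hgJ hcov,
        nabla_inv hJ hJinv hginv hgJ hcov, tor, tor, inv_one, inv_one, inv_one, sub_sub,
        sub_eq_zero] at h
      exact h }

/-- A left-invariant Hermitian metric with parallel Bismut torsion on a Lie group with nilpotent
complex structure has parallel Bismut curvature. -/
theorem hasParallelCurvature (hJ : IsComplexStructure J) (hJinv : IsLeftInvariantJ J)
    (hJnil : IsNilpotentJ (endAtOne J))
    (hginv : IsLeftInvariantMetric g) (hgJ : IsCompatible J g) (hcov : IsBismut J g cov)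
    (hpar : HasParallelTorsion cov) : HasParallelCurvature cov := by
  have : FiniteDimensional ℝ (GroupLieAlgebra 𝓘(ℝ, E) G) := ‹FiniteDimensional ℝ E›
  let D := parallelSkewTorsion hJ hJinv hginv hgJ hcov hpar
  have hn (u v : GroupLieAlgebra 𝓘(ℝ, E) G) : nabla cov (inv u) (inv v) = inv (D.A u v) :=
    nabla_inv hJ hJinv hginv hgJ hcov u v
  obtain ⟨s, hs⟩ := hJnil
  have h2 : ∀ x y, D.br x y ∈ D.complexCenter :=
    ParallelSkewTorsion.br_mem_center s D (ascendingSeries (endAtOne J)) rfl hs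
      (fun l x hx y ↦ hx y)
  -- The commutator of `A x` and `A y` vanishes, leaving only the bracket term of the curvature.
  have hR (x y z : GroupLieAlgebra 𝓘(ℝ, E) G) :
      curvature cov (inv x) (inv y) (inv z) = inv (-D.A (D.br x y) z) := by
    rw [curvature_def, hn, hn, hn, hn, mlieBracket_inv, hn, ParallelSkewTorsion.A_comm h2, sub_self,
      zero_sub, inv_neg]
    rfl
  obtain ⟨n, e, he⟩ := exists_invariant_frame hginv
  refine hasParallelCurvature_of_frame hcov.smooth (fun i ↦ isSmoothField_inv (e i)) he
    fun i j k l ↦ ?_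
  generalize e i = w, e j = x, e k = y, e l = z
  have hder := congrArg (fun L ↦ L z) (ParallelSkewTorsion.A_br_derivation h2 w x y)
  simp only [LinearMap.neg_apply] at hder
  rw [nablaCurvature, hR, hn, hn, hn, hn, hR, hR, hR, ← inv_sub, ← inv_sub, ← inv_sub,
    hder, map_neg, ParallelSkewTorsion.A_comm h2, ← inv_zero]
  congr 1
  abel

end Bismut

end BismutNil

theorem proposition1p7
    {E : Type*} [NormedAddCommGroup E] [NormedSpace ℝ E] [FiniteDimensional ℝ E] [CompleteSpace E]
    {G : Type*} [TopologicalSpace G] [ChartedSpace E G] [Group G] [LieGroup 𝓘(ℝ, E) ∞ G]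
    (hG : LieRing.IsNilpotent (GroupLieAlgebra 𝓘(ℝ, E) G))
    (J : Π x : G, TangentSpace 𝓘(ℝ, E) x →L[ℝ] TangentSpace 𝓘(ℝ, E) x)
    (hJ : BismutNil.IsComplexStructure J)
    (hJinv : BismutNil.IsLeftInvariantJ J)
    (hJnil : BismutNil.IsNilpotentJ (BismutNil.endAtOne J))
    (g : BismutNil.RiemMetric E G)
    (hginv : BismutNil.IsLeftInvariantMetric g)
    (hgJ : BismutNil.IsCompatible J g)
    (hBTP : BismutNil.IsBTP J g) :
    BismutNil.IsBAS J g := by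
  obtain ⟨cov, hcov, hpar⟩ := hBTP
  exact ⟨cov, hcov, hpar,
    BismutNil.hasParallelCurvature hJ hJinv hJnil hginv hgJ hcov hpar⟩
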